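/- **Setting.** Let $(A,\rho,D,U)$ be an oriented quantum algebra over a commutative ring $k$: $\rho\in A\otimes A$ is an invertible solution of $\rho_{12}\rho_{13}\rho_{23}=\rho_{23}\rho_{13}\rho_{12}$, $U$ and $D$ are commuting algebra automorphisms of $A$ with $(U\otimes U)\rho=\rho=(D\otimes D)\rho$, and $(1\otimes U)\rho$ and $(D\otimes 1)\rho^{-1}$ are inverse to each other in $A\otimes A^{op}$. Put $t=UD=DU$ and write $\rho=\sum e\otimes e'$, $\rho^{-1}=\sum E\otimes E'$. Let $T$ be an oriented $1$-$1$ tangle diagram with one component, in Morse position with respect to the vertical direction (a stack of cups, caps and crossings of all orientations). Flatten every crossing and put beads on it: $e$ on the over- and $e'$ on the undercrossing strand of a positive crossing, $E$ on the over- and $E'$ on the undercrossing strand of a negative one. If the two strands of the crossing do not both point up or both point down, apply in addition $U$ (crossing pointing to the right) or $D$ (crossing pointing to the left) to the bead on the strand that joins the lower left and the upper right corner. A bead that is slid along the strand passes through crossings unchanged. If it is slid counterclockwise around a cap (from its right to its left leg) it is changed by $U$ if the left leg is rising and by $D$ if the left leg is falling. If it is slid counterclockwise around a cup (from its left to its right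 leg) it is changed by $U$ if the right leg is rising and by $D$ if the right leg is falling. Clockwise turns apply the inverse automorphisms. Slide all beads to one end of the diagram (say, the top). Reading them in the order of the orientation of the strand and summing over the signifiers of all the crossings gives an expression $w$, a formal sum of formal products of elements of $A$ (an element of the tensor algebra of the $k$-module $A$). Write $Inv(T)=G^n w$ if moreover the flat diagram that remains is regularly homotopic (flat Reidemeister moves of type two and three, cancellation of maxima against minima, switchback moves, and height interchange, but not type one) to a string of $|n|$ curls, clockwise curls $G$ if $n\ge 0$ and counterclockwise curls $G^{-1}$ if $n<0$. **Proposition.** Let $r(T)$ be $T$ with its orientation reversed, and let $r(w)$ be obtained from $w$ by reversing the order of the products. 1. If $Inv(T)=G^n w$, then $Inv(r(T))=G^{-n}\,r(w)$. This holds whichever end of the diagram, top or bottom, the beads of $T$ and those of $r(T)$ are slid to. 2. The algebra expression $w$ involves only powers of $t$: it is equal, as a formal sum of products, to the expression obtained by replacing the composition of $U^{\pm1}$ and $D^{\pm1}$ applied to each bead by a suitable integer power of $t$. -/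

import Mathlib

open scoped TensorProduct

noncomputable section

namespace QTangle

/-! ### Oriented quantum algebras -/

/-- `ρ₁₂`, for `ρ ∈ A ⊗ A`, in `A ⊗ (A ⊗ A)`. -/
def place12 (k A : Type*) [CommRing k] [Ring A] [Algebra k A] :
    A ⊗[k] A →ₐ[k] A ⊗[k] (A ⊗[k] A) :=
  Algebra.TensorProduct.map (AlgHom.id k A) Algebra.TensorProduct.includeLeft

/-- `ρ₁₃`, for `ρ ∈ A ⊗ A`, in `A ⊗ (A ⊗ A)`. -/
def place13 (k A : Type*) [CommRing k] [Ring A] [Algebra k A] :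
    A ⊗[k] A →ₐ[k] A ⊗[k] (A ⊗[k] A) :=
  Algebra.TensorProduct.map (AlgHom.id k A) Algebra.TensorProduct.includeRight

/-- `ρ₂₃`, for `ρ ∈ A ⊗ A`, in `A ⊗ (A ⊗ A)`. -/
def place23 (k A : Type*) [CommRing k] [Ring A] [Algebra k A] :
    A ⊗[k] A →ₐ[k] A ⊗[k] (A ⊗[k] A) :=
  Algebra.TensorProduct.includeRight

/-- The linear map `f ⊗ g : A ⊗ A → A ⊗ Aᵒᵖ`, for `k`-linear `f g : A → A`. -/
def mapOp {k A : Type*} [CommRing k] [Ring A] [Algebra k A] (f g : A →ₗ[k] A) :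
    A ⊗[k] A →ₗ[k] A ⊗[k] Aᵐᵒᵖ :=
  TensorProduct.map f ((MulOpposite.opLinearEquiv k).toLinearMap ∘ₗ g)

/-- An oriented quantum algebra structure `(A, ρ, D, U)` on a `k`-algebra `A`. -/
structure OrientedQuantumAlgebra (k A : Type*) [CommRing k] [Ring A] [Algebra k A] where
  ρ : (A ⊗[k] A)ˣ
  D : A ≃ₐ[k] A
  U : A ≃ₐ[k] A
  yangBaxter : place12 k A ρ * place13 k A ρ * place23 k A ρ =
    place23 k A ρ * place13 k A ρ * place12 k A ρ
  commute_DU : D * U = U * D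
  U_ρ : TensorProduct.map U.toLinearMap U.toLinearMap (ρ : A ⊗[k] A) = ρ
  D_ρ : TensorProduct.map D.toLinearMap D.toLinearMap (ρ : A ⊗[k] A) = ρ
  mul_eq_one : mapOp LinearMap.id U.toLinearMap (ρ : A ⊗[k] A) *
    mapOp D.toLinearMap LinearMap.id (↑ρ⁻¹ : A ⊗[k] A) = 1
  mul_eq_one' : mapOp D.toLinearMap LinearMap.id (↑ρ⁻¹ : A ⊗[k] A) *
    mapOp LinearMap.id U.toLinearMap (ρ : A ⊗[k] A) = 1

/-- The automorphism `t = UD = DU`. -/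
def OrientedQuantumAlgebra.t {k A : Type*} [CommRing k] [Ring A] [Algebra k A]
    (Q : OrientedQuantumAlgebra k A) : A ≃ₐ[k] A := Q.U * Q.D

/-- Signifiers: a way of writing `ρ = ∑ e ⊗ e'` and `ρ⁻¹ = ∑ E ⊗ E'` as finite sums. -/
structure Signifiers {k A : Type*} [CommRing k] [Ring A] [Algebra k A]
    (Q : OrientedQuantumAlgebra k A) (ι κ : Type*) [Fintype ι] [Fintype κ] where
  e : ι → A
  e' : ι → A
  E : κ → A
  E' : κ → A
  ρ_eq : (Q.ρ : A ⊗[k] A) = ∑ i, e i ⊗ₜ[k] e' i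
  ρ_inv_eq : (↑Q.ρ⁻¹ : A ⊗[k] A) = ∑ j, E j ⊗ₜ[k] E' j

/-! ### Oriented Morse diagrams of tangles

Signs are Booleans: `true` is `+` (upward), `false` is `-` (downward).  Diagrams are read from
bottom to top. -/

/-- An elementary oriented tangle, with crossings decorated by `X`.
* `cup s`: a minimum, no inputs, outputs `s, -s`;
* `cap s`: a maximum, inputs `s, -s`, no outputs;
* `cross x s₁ s₂`: inputs `s₁, s₂`, outputs `s₂, s₁`.  The strand of sign `s₁` runs between the
  lower left and the upper right corner (the `/` strand), the one of sign `s₂` between the lower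
  right and the upper left corner (the `\` strand). -/
inductive Piece (X : Type) where
  | cup (s : Bool)
  | cap (s : Bool)
  | cross (x : X) (s₁ s₂ : Bool)

namespace Piece
variable {X Y : Type}

/-- The signs of the inputs. -/
def dom : Piece X → List Bool
  | cup _ => []
  | cap s => [s, !s]
  | cross _ s₁ s₂ => [s₁, s₂]

/-- The signs of the outputs. -/
def cod : Piece X → List Bool
  | cup s => [s, !s]
  | cap _ => []
  | cross _ s₁ s₂ => [s₂, s₁]

/-- Change of the decoration of the crossings. -/
def map (f : X → Y) : Piece X → Piece Y
  | cup s => cup s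
  | cap s => cap s
  | cross x s₁ s₂ => cross (f x) s₁ s₂

/-- Reversal of all the orientations; the picture does not change otherwise. -/
def rev : Piece X → Piece X
  | cup s => cup !s
  | cap s => cap !s
  | cross x s₁ s₂ => cross x (!s₁) (!s₂)

end Piece

/-- An elementary tangle with vertical strands to its left and to its right. -/
structure Layer (X : Type) where
  left : List Bool
  piece : Piece X
  right : List Bool

namespace Layer
variable {X Y : Type}

def dom (L : Layer X) : List Bool := L.left ++ L.piece.dom ++ L.right

def cod (L : Layer X) : List Bool := L.left ++ L.piece.cod ++ L.right

def map (f : X → Y) (L : Layer X) : Layer Y := ⟨L.left, L.piece.map f, L.right⟩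

def rev (L : Layer X) : Layer X := ⟨L.left.map not, L.piece.rev, L.right.map not⟩

/-- Juxtaposition with vertical strands `l` on the left and `r` on the right. -/
def pad (l r : List Bool) (L : Layer X) : Layer X := ⟨l ++ L.left, L.piece, L.right ++ r⟩

theorem dom_rev (L : Layer X) : L.rev.dom = L.dom.map not := by
  rcases L with ⟨l, p, r⟩
  cases p <;> simp [rev, dom, Piece.rev, Piece.dom]

theorem cod_rev (L : Layer X) : L.rev.cod = L.cod.map not := by
  rcases L with ⟨l, p, r⟩
  cases p <;> simp [rev, cod, Piece.rev, Piece.cod]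

/-- The other end of the strand of the layer that starts at a given end.  An end is given by a
Boolean (`true`: on the upper edge, `false`: on the lower edge of the layer) and a position on
that edge, counted from the left, starting with `0`. -/
def across (L : Layer X) (top : Bool) (p : ℕ) : Bool × ℕ :=
  let l := L.left.length
  match L.piece, top with
  | .cross _ _ _, _ => (!top, if p = l then l + 1 else if p = l + 1 then l else p)
  | .cup _, false => (true, if p < l then p else p + 2)
  | .cup _, true =>
      if p < l then (false, p) else if p = l then (true, l + 1)
      else if p = l + 1 then (true, l) else (false, p - 2)
  | .cap _, true => (false, if p < l then p else p + 2)
  | .cap _, false =>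
      if p < l then (true, p) else if p = l then (false, l + 1)
      else if p = l + 1 then (false, l) else (true, p - 2)

end Layer

/-- `IsMor a d b`: the layers `d`, stacked from bottom to top, form a diagram with input signs
`a` and output signs `b`. -/
def IsMor {X : Type} : List Bool → List (Layer X) → List Bool → Prop
  | a, [], b => a = b
  | a, L :: d, b => a = L.dom ∧ IsMor L.cod d b

theorem IsMor.rev {X : Type} : ∀ {a b : List Bool} {d : List (Layer X)}, IsMor a d b →
    IsMor (a.map not) (d.map Layer.rev) (b.map not)
  | _, _, [], h => congrArg (List.map not) h
  | _, _, L :: _, ⟨h₁, h₂⟩ =>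
      ⟨by rw [h₁, L.dom_rev], by rw [L.cod_rev]; exact h₂.rev⟩

/-- An oriented tangle diagram from `a` to `b`.  The Boolean of a crossing tells whether the
`/` strand (`true`) or the `\` strand (`false`) is the overcrossing one. -/
structure Tangle (a b : List Bool) where
  layers : List (Layer Bool)
  isMor : IsMor a layers b

namespace Tangle
variable {a b : List Bool}

/-- `r(T)`: the same diagram with all orientations reversed. -/
def rev (T : Tangle a b) : Tangle (a.map not) (b.map not) :=
  ⟨T.layers.map Layer.rev, T.isMor.rev⟩

/-- The underlying flat diagram. -/
def flat (T : Tangle a b) : List (Layer Unit) := T.layers.map (Layer.map fun _ => ())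

/-- The number of strands that cross the level below layer number `i` (the top of the diagram,
if `i` is the number of layers). -/
def width (T : Tangle a b) (i : ℕ) : ℕ :=
  match T.layers[i]? with
  | some L => L.dom.length
  | none => b.length

end Tangle

/-! ### Walking along a strand -/

/-- A point of a diagram, between two layers: the number of the level (`0` is the bottom, level
`i` lies below layer `i`), the position from the left, and the vertical direction in which the
walk passes this point (which need not be the orientation of the strand). -/
structure Pt where
  level : ℕ
  pos : ℕ
  up : Bool

/-- The layer that the walk enters at a point: its number, the layer, and whether it is entered
through its upper edge. -/
def entered {X : Type} (d : List (Layer X)) (x : Pt) : Option (ℕ × Layer X × Bool) :=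
  if x.up then d[x.level]?.map fun L => (x.level, L, false)
  else if x.level = 0 then none
  else d[x.level - 1]?.map fun L => (x.level - 1, L, true)

/-- The next point of the walk. -/
def next {X : Type} (d : List (Layer X)) (x : Pt) : Option Pt :=
  (entered d x).map fun y =>
    let q := y.2.1.across y.2.2 x.pos
    if q.1 then ⟨y.1 + 1, q.2, true⟩ else ⟨y.1, q.2, false⟩

/-- `path` is the walk through the `1-1` diagram `T` along its strand from the bottom to the
top, and this walk passes through every point of the diagram exactly once. -/
structure Tangle.IsTraversal {s s' : Bool} (T : Tangle [s] [s']) (path : List Pt) : Prop where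
  start : path.head? = some ⟨0, 0, true⟩
  chain : path.IsChain fun x y => next T.layers x = some y
  finish : path.getLast? = some ⟨T.layers.length, 0, true⟩
  nodup : (path.map fun x => (x.level, x.pos)).Nodup
  covers : ∀ i ≤ T.layers.length, ∀ p < T.width i, (i, p) ∈ path.map fun x => (x.level, x.pos)

/-- A `1-1` tangle diagram of one component: there are no strings but the one from the bottom
to the top. -/
def Tangle.OneComponent {s s' : Bool} (T : Tangle [s] [s']) : Prop := ∃ path, T.IsTraversal path

/-! ### Beads and bead sliding -/

/-- A bead: the number of the layer of the crossing it comes from, whether it is the second of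
the two signifiers of that crossing, and the operator `U ^ i D ^ j` applied to it, as `(i, j)`. -/
structure Bead where
  crossing : ℕ
  second : Bool
  op : ℤ × ℤ

/-- What a walk along a strand meets in a layer: a bead, or a maximum or minimum, the passage of
which, in the direction of the walk, applies the operator `U ^ i D ^ j` to a bead. -/
inductive Event where
  | bead (b : Bead)
  | turn (v : ℤ × ℤ)

/-- The operator of a counterclockwise turn around a cap whose left leg, or a cup whose right
leg, is rising (`U`) or falling (`D`). -/
def turnOp (rising : Bool) : ℤ × ℤ := if rising then (1, 0) else (0, 1)

/-- Whether a crossing is decorated with `ρ` (`true`, a positive crossing) or with `ρ⁻¹`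
(`false`, a negative crossing). -/
def positive (slashOver s₁ s₂ : Bool) : Bool := if s₁ = s₂ then slashOver else !slashOver

/-- The decoration of a crossing, on its `/` strand or on its `\` strand.  The overcrossing
strand carries the first signifier, the undercrossing strand the second one.  If both strands
point upward or both point downward, no operator is applied; if they point to the right
(to the left), `U` (`D`) is applied to the bead of the `/` strand. -/
def crossingBead (c : ℕ) (slashOver s₁ s₂ : Bool) (onSlash : Bool) : Bead :=
  if onSlash then ⟨c, !slashOver, if s₁ = s₂ then 0 else turnOp s₁⟩ else ⟨c, slashOver, 0⟩

/-- What is met in layer number `i` when it is entered at position `p`, through its upper edge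
(`top = true`) or through its lower edge. -/
def Layer.event (i : ℕ) (L : Layer Bool) (top : Bool) (p : ℕ) : Option Event :=
  let l := L.left.length
  match L.piece, top with
  | .cross o s₁ s₂, false =>
      if p = l then some (.bead (crossingBead i o s₁ s₂ true))
      else if p = l + 1 then some (.bead (crossingBead i o s₁ s₂ false)) else none
  | .cross o s₁ s₂, true =>
      if p = l then some (.bead (crossingBead i o s₁ s₂ false))
      else if p = l + 1 then some (.bead (crossingBead i o s₁ s₂ true)) else none
  | .cup s, true =>
      if p = l then some (.turn (turnOp !s))
      else if p = l + 1 then some (.turn (-turnOp !s)) else none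
  | .cap s, false =>
      if p = l then some (.turn (-turnOp s))
      else if p = l + 1 then some (.turn (turnOp s)) else none
  | .cup _, false => none
  | .cap _, true => none

/-- The beads and turns met along a walk, in the order of the walk. -/
def Tangle.events {a b : List Bool} (T : Tangle a b) (path : List Pt) : List Event :=
  path.filterMap fun x => (entered T.layers x).bind fun y => y.2.1.event y.1 y.2.2 x.pos

/-- The total operator of the turns in a list. -/
def netTurn : List Event → ℤ × ℤ
  | [] => 0
  | .turn v :: es => v + netTurn es
  | .bead _ :: es => netTurn es

/-- Slide all beads forward, to the end of the walk. -/
def slideForward : List Event → List Bead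
  | [] => []
  | .turn _ :: es => slideForward es
  | .bead b :: es => { b with op := b.op + netTurn es } :: slideForward es

/-- Slide all beads backward, to the start of the walk; `v` is the total operator of the turns
already passed by the walk. -/
def slideBackward (v : ℤ × ℤ) : List Event → List Bead
  | [] => []
  | .turn u :: es => slideBackward (v + u) es
  | .bead b :: es => { b with op := b.op - v } :: slideBackward v es

/-- The beads of a one-component `1-1` tangle diagram after they have been slid to the top
(`toTop = true`) or to the bottom of the diagram, in the order of the orientation of the strand.
Here `path` is the walk from the bottom to the top. -/
def Tangle.slide {s s' : Bool} (toTop : Bool) (T : Tangle [s] [s']) (path : List Pt) :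
    List Bead :=
  let w := if toTop then slideForward (T.events path) else slideBackward 0 (T.events path)
  if s then w else w.reverse

/-- The crossings of a diagram: the number of the layer, and whether the crossing is positive. -/
def Tangle.crossings {a b : List Bool} (T : Tangle a b) : List (ℕ × Bool) :=
  T.layers.zipIdx.filterMap fun x =>
    match x.1.piece with
    | .cross o s₁ s₂ => some (x.2, positive o s₁ s₂)
    | _ => none

/-! ### Algebra expressions

An expression is a formal sum of formal products of elements of `A`, that is, an element of the
tensor algebra of the module `A`. -/

section Expressions
variable {k A : Type*} [CommRing k] [Ring A] [Algebra k A]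

/-- `r(w)`: reversal of the order of the products. -/
def reverseProducts (k A : Type*) [CommRing k] [Ring A] [Algebra k A] :
    TensorAlgebra k A →ₗ[k] TensorAlgebra k A :=
  (MulOpposite.opLinearEquiv k).symm.toLinearMap ∘ₗ
    (TensorAlgebra.lift k
      ((MulOpposite.opLinearEquiv k).toLinearMap ∘ₗ TensorAlgebra.ι k (M := A))).toLinearMap

/-- A letter of a formal word: one of the two signifiers of a crossing, with an automorphism of
`A` applied to it. -/
structure Letter (k A : Type*) [CommRing k] [Ring A] [Algebra k A] where
  crossing : ℕ
  second : Bool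
  op : A ≃ₐ[k] A

/-- The formal product of a word, where `x c false` and `x c true` are the values of the first
and the second signifier of the crossing `c`. -/
def wordProd (w : List (Letter k A)) (x : ℕ → Bool → A) : TensorAlgebra k A :=
  (w.map fun b => TensorAlgebra.ι k (b.op (x b.crossing b.second))).prod

/-- Summation of `f` over the signifiers `e ⊗ e'` of all the positive and `E ⊗ E'` of all the
negative crossings in a list. -/
def sumSignifiers {Q : OrientedQuantumAlgebra k A} {ι κ : Type*} [Fintype ι] [Fintype κ]
    (S : Signifiers Q ι κ) (f : (ℕ → Bool → A) → TensorAlgebra k A) :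
    List (ℕ × Bool) → (ℕ → Bool → A) → TensorAlgebra k A
  | [], x => f x
  | (c, true) :: cs, x =>
      ∑ i, sumSignifiers S f cs
        (Function.update x c fun second => if second then S.e' i else S.e i)
  | (c, false) :: cs, x =>
      ∑ j, sumSignifiers S f cs
        (Function.update x c fun second => if second then S.E' j else S.E j)

/-- The formal sum of products given by a word in the signifiers of the crossings of `T`. -/
def Tangle.expr {a b : List Bool} (T : Tangle a b) {Q : OrientedQuantumAlgebra k A}
    {ι κ : Type*} [Fintype ι] [Fintype κ] (S : Signifiers Q ι κ) (w : List (Letter k A)) :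
    TensorAlgebra k A :=
  sumSignifiers S (wordProd w) T.crossings fun _ _ => 0

/-- The letter of a bead. -/
def Bead.letter (Q : OrientedQuantumAlgebra k A) (b : Bead) : Letter k A :=
  ⟨b.crossing, b.second, Q.U ^ b.op.1 * Q.D ^ b.op.2⟩

/-- The letter of a bead, with a given power of `t` in the place of its operator. -/
def Bead.tLetter (Q : OrientedQuantumAlgebra k A) (m : ℕ → Bool → ℤ) (b : Bead) : Letter k A :=
  ⟨b.crossing, b.second, Q.t ^ m b.crossing b.second⟩

end Expressions

/-! ### Regular homotopy of flat diagrams -/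

/-- The elementary moves of flat diagrams. -/
inductive FlatMove : List (Layer Unit) → List (Layer Unit) → Prop
  /-- two elementary tangles over different strands are interchanged in height -/
  | interchange (P P' : Piece Unit) (m : List Bool) :
      FlatMove [⟨[], P, m ++ P'.dom⟩, ⟨P.cod ++ m, P', []⟩]
        [⟨P.dom ++ m, P', []⟩, ⟨[], P, m ++ P'.cod⟩]
  /-- cancellation of a maximum and a minimum -/
  | zigzag (s : Bool) : FlatMove [⟨[s], .cup !s, []⟩, ⟨[], .cap s, [s]⟩] []
  | zigzag' (s : Bool) : FlatMove [⟨[], .cup s, [s]⟩, ⟨[s], .cap !s, []⟩] []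
  /-- flat second Reidemeister move -/
  | two (s₁ s₂ : Bool) : FlatMove [⟨[], .cross () s₁ s₂, []⟩, ⟨[], .cross () s₂ s₁, []⟩] []
  /-- flat third Reidemeister move -/
  | three (s₁ s₂ s₃ : Bool) :
      FlatMove
        [⟨[], .cross () s₁ s₂, [s₃]⟩, ⟨[s₂], .cross () s₁ s₃, []⟩, ⟨[], .cross () s₂ s₃, [s₁]⟩]
        [⟨[s₁], .cross () s₂ s₃, []⟩, ⟨[], .cross () s₁ s₃, [s₂]⟩, ⟨[s₃], .cross () s₁ s₂, []⟩]
  /-- switchback moves: a strand passes a maximum or a minimum -/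
  | switchCap (s x : Bool) :
      FlatMove [⟨[s], .cross () x !s, []⟩, ⟨[], .cap s, [x]⟩]
        [⟨[], .cross () s x, [!s]⟩, ⟨[x], .cap s, []⟩]
  | switchCup (s x : Bool) :
      FlatMove [⟨[x], .cup s, []⟩, ⟨[], .cross () x s, [!s]⟩]
        [⟨[], .cup s, [x]⟩, ⟨[s], .cross () (!s) x, []⟩]

/-- One elementary move performed inside of a flat diagram from `a` to `b`. -/
def FlatStep (a b : List Bool) (d d' : List (Layer Unit)) : Prop :=
  IsMor a d b ∧ IsMor a d' b ∧ ∃ below above u v l r, FlatMove u v ∧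
    d = below ++ u.map (Layer.pad l r) ++ above ∧ d' = below ++ v.map (Layer.pad l r) ++ above

/-- Regular homotopy of flat diagrams from `a` to `b`. -/
def FlatEquiv (a b : List Bool) : List (Layer Unit) → List (Layer Unit) → Prop :=
  Relation.EqvGen (FlatStep a b)

/-- The flat curl on a strand of sign `s` whose loop lies on the right of the strand. It turns
clockwise if `s` is `+`, and counterclockwise if `s` is `-`. -/
def curlRight (s : Bool) : List (Layer Unit) :=
  [⟨[s], .cup s, []⟩, ⟨[], .cross () s s, [!s]⟩, ⟨[s], .cap s, []⟩]

/-- The flat curl on a strand of sign `s` whose loop lies on the left of the strand. It turns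
counterclockwise if `s` is `+`, and clockwise if `s` is `-`. -/
def curlLeft (s : Bool) : List (Layer Unit) :=
  [⟨[], .cup !s, [s]⟩, ⟨[!s], .cross () s s, []⟩, ⟨[], .cap !s, [s]⟩]

/-- `G ^ n` on a strand of sign `s`, where `G` is the clockwise curl and `G⁻¹` the
counterclockwise curl: a string of `|n|` equal curls. -/
def curls (s : Bool) (n : ℤ) : List (Layer Unit) :=
  (List.replicate n.natAbs (if s = decide (0 ≤ n) then curlRight s else curlLeft s)).flatten

/-- `w` is the algebra expression that the beads of the decorated flat diagram of the
one-component `1-1` tangle diagram `T` form when they are all slid to the top of the diagram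
(`toTop = true`; otherwise to the bottom). -/
def HasExpr {k A : Type*} [CommRing k] [Ring A] [Algebra k A]
    {Q : OrientedQuantumAlgebra k A} {ι κ : Type*} [Fintype ι] [Fintype κ]
    (S : Signifiers Q ι κ) (toTop : Bool) {s : Bool} (T : Tangle [s] [s])
    (w : TensorAlgebra k A) : Prop :=
  ∃ path, T.IsTraversal path ∧ w = T.expr S ((T.slide toTop path).map (Bead.letter Q))

/-- `Inv(T) = G ^ n w`, for a one-component `1-1` tangle diagram `T`: when all the beads are slid
to one end of the diagram (to the top, or to the bottom if `toTop` is `false`), they form the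
algebra expression `w`, and the flat diagram that remains is regularly homotopic to `G ^ n`. -/
def HasInv {k A : Type*} [CommRing k] [Ring A] [Algebra k A]
    {Q : OrientedQuantumAlgebra k A} {ι κ : Type*} [Fintype ι] [Fintype κ]
    (S : Signifiers Q ι κ) (toTop : Bool) {s : Bool} (T : Tangle [s] [s]) (n : ℤ)
    (w : TensorAlgebra k A) : Prop :=
  HasExpr S toTop T w ∧ FlatEquiv [s] [s] T.flat (curls s n)

end QTangle

end

/-! Two facts carry the proof. Algebraically, every `U ^ i * D ^ j` fixes ρ and ρ⁻¹ diagonally, and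
each signifier of each crossing occurs exactly once in the word. The word is therefore bilinear in
the two signifiers of a crossing, and applying one operator `U ^ i * D ^ j` to both beads of a
crossing does not change the expression (`Tangle.expr_map_shift`).

Geometrically, let the weight of an operator be its exponent of `U` minus that of `D`. The weight of
a turn is the height of the sign after it minus the height before it; the initial weight of a bead
compares the sign of its strand with that of the `\` strand of its crossing. These differences
telescope, so a bead slid to the top has a weight that depends on its crossing only
(`Tangle.IsTraversal.weight_eq`).

Reversal keeps the walk, exchanges `U` and `D` and reverses the reading order. The exchange alters
the exponents by a multiple of the weight, equally on both beads of a crossing, hence invisibly.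
Sliding to the other end applies one common operator to all beads. Subtracting the weight from the
exponent of `U` leaves powers of `t`. On flat diagrams, the moves are stable under reversal, and a
curl keeps the side of its loop but turns the other way. -/

namespace QTangle

/-! ### Invariance of expressions under automorphisms that preserve `ρ` -/

section Algebra
variable {k A : Type*} [CommRing k] [Ring A] [Algebra k A]

/-- The automorphisms `g` of `A` with `(g ⊗ g) ρ = ρ`. -/
def OrientedQuantumAlgebra.stabilizer (Q : OrientedQuantumAlgebra k A) : Subgroup (A ≃ₐ[k] A) where
  carrier := {g | Algebra.TensorProduct.map (g : A →ₐ[k] A) (g : A →ₐ[k] A) (Q.ρ : A ⊗[k] A) = Q.ρ}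
  one_mem' := by
    have h : Algebra.TensorProduct.map ((1 : A ≃ₐ[k] A) : A →ₐ[k] A) ((1 : A ≃ₐ[k] A) : A →ₐ[k] A) =
        AlgHom.id k (A ⊗[k] A) := by
      ext <;> simp
    exact DFunLike.congr_fun h _
  mul_mem' := by
    intro a b ha hb
    have h : Algebra.TensorProduct.map ((a * b : A ≃ₐ[k] A) : A →ₐ[k] A)
        ((a * b : A ≃ₐ[k] A) : A →ₐ[k] A) =
        (Algebra.TensorProduct.map (a : A →ₐ[k] A) (a : A →ₐ[k] A)).comp
          (Algebra.TensorProduct.map (b : A →ₐ[k] A) (b : A →ₐ[k] A)) := by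
      ext <;> simp
    simp only [Set.mem_ofPred_eq] at ha hb ⊢
    rw [h, AlgHom.comp_apply, hb, ha]
  inv_mem' := by
    intro a ha
    have h : (Algebra.TensorProduct.map ((a⁻¹ : A ≃ₐ[k] A) : A →ₐ[k] A)
        ((a⁻¹ : A ≃ₐ[k] A) : A →ₐ[k] A)).comp
          (Algebra.TensorProduct.map (a : A →ₐ[k] A) (a : A →ₐ[k] A)) =
        AlgHom.id k (A ⊗[k] A) := by
      ext <;> simp [← AlgEquiv.mul_apply]
    simp only [Set.mem_ofPred_eq] at ha ⊢
    conv_lhs => rw [← ha]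
    exact DFunLike.congr_fun h _

theorem OrientedQuantumAlgebra.zpow_mul_zpow_mem_stabilizer (Q : OrientedQuantumAlgebra k A)
    (i j : ℤ) : Q.U ^ i * Q.D ^ j ∈ Q.stabilizer :=
  mul_mem (zpow_mem (show Q.U ∈ Q.stabilizer from Q.U_ρ) i)
    (zpow_mem (show Q.D ∈ Q.stabilizer from Q.D_ρ) j)

/-- Since `U` and `D` commute, exponent pairs act as the group ℤ², so sliding amounts to adding
pairs. -/
theorem OrientedQuantumAlgebra.zpow_mul_zpow_add (Q : OrientedQuantumAlgebra k A) (v u : ℤ × ℤ) :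
    Q.U ^ (v + u).1 * Q.D ^ (v + u).2 = (Q.U ^ v.1 * Q.D ^ v.2) * (Q.U ^ u.1 * Q.D ^ u.2) := by
  have h : Commute Q.D Q.U := Q.commute_DU
  have h' : Q.D ^ v.2 * Q.U ^ u.1 = Q.U ^ u.1 * Q.D ^ v.2 := (h.zpow_zpow v.2 u.1).eq
  rw [Prod.fst_add, Prod.snd_add, zpow_add, zpow_add, mul_assoc, mul_assoc,
    ← mul_assoc (Q.D ^ v.2), h', mul_assoc]

/-- `F` is bilinear in the values of the two signifiers of the crossing `c`. -/
def BilinearAt (F : (ℕ → Bool → A) → TensorAlgebra k A) (c : ℕ) : Prop :=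
  ∀ x : ℕ → Bool → A, ∃ L : A ⊗[k] A →ₗ[k] TensorAlgebra k A, ∀ a a',
    F (Function.update x c fun second => if second then a' else a) = L (a ⊗ₜ a')

/-- Summing over the other crossings preserves bilinearity. A second occurrence of `c` would
overwrite its values, which is why `c` must not be listed. -/
theorem BilinearAt.sumSignifiers {Q : OrientedQuantumAlgebra k A} {ι κ : Type*} [Fintype ι]
    [Fintype κ] (S : Signifiers Q ι κ) {F : (ℕ → Bool → A) → TensorAlgebra k A} {c : ℕ}
    (hF : BilinearAt F c) : ∀ cs : List (ℕ × Bool), c ∉ cs.map Prod.fst →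
      BilinearAt (sumSignifiers S F cs) c
  | [], _ => hF
  | (d, true) :: cs, hc => by
    simp only [List.map_cons, List.mem_cons, not_or] at hc
    intro x
    choose L hL using fun i => hF.sumSignifiers S cs hc.2
      (Function.update x d fun second => if second then S.e' i else S.e i)
    refine ⟨∑ i, L i, fun a a' => ?_⟩
    simp only [QTangle.sumSignifiers, LinearMap.sum_apply, ← hL, Function.update_comm hc.1]
  | (d, false) :: cs, hc => by
    simp only [List.map_cons, List.mem_cons, not_or] at hc
    intro x
    choose L hL using fun i => hF.sumSignifiers S cs hc.2
      (Function.update x d fun second => if second then S.E' i else S.E i)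
    refine ⟨∑ i, L i, fun a a' => ?_⟩
    simp only [QTangle.sumSignifiers, LinearMap.sum_apply, ← hL, Function.update_comm hc.1]

/-- One crossing is treated at a time: the sum over the remaining crossings is a linear function `L`
of `a ⊗ a'`, so the sum over this crossing is `L` applied to `(g ⊗ g) ρ = ρ`, or to the same
identity for ρ⁻¹. -/
theorem sumSignifiers_comp_stabilizer {Q : OrientedQuantumAlgebra k A} {ι κ : Type*} [Fintype ι]
    [Fintype κ] (S : Signifiers Q ι κ) {F : (ℕ → Bool → A) → TensorAlgebra k A}
    {g : ℕ → A ≃ₐ[k] A} (hg : ∀ c, g c ∈ Q.stabilizer) :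
    ∀ (cs : List (ℕ × Bool)), (cs.map Prod.fst).Nodup → (∀ c ∈ cs.map Prod.fst, BilinearAt F c) →
      ∀ x : ℕ → Bool → A, sumSignifiers S (fun x => F fun c b => g c (x c b)) cs x =
        sumSignifiers S F cs fun c b => g c (x c b)
  | [], _, _, _ => rfl
  | (c, sign) :: cs, hn, hF, x => by
    rw [List.map_cons, List.nodup_cons] at hn
    obtain ⟨L, hL⟩ := (hF c (by simp)).sumSignifiers S cs hn.1 fun c b => g c (x c b)
    have ih := sumSignifiers_comp_stabilizer S hg cs hn.2
      fun c hc => hF c (List.mem_cons_of_mem _ hc)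
    have key : ∀ a a' : A, sumSignifiers S (fun x => F fun c b => g c (x c b)) cs
        (Function.update x c fun second => if second then a' else a) = L (g c a ⊗ₜ g c a') := by
      intro a a'
      rw [ih, ← hL]
      congr 1
      funext d b
      by_cases hd : d = c
      · subst hd
        cases b <;> simp
      · simp [hd]
    have hρ : Algebra.TensorProduct.map (g c : A →ₐ[k] A) (g c : A →ₐ[k] A)
        (Q.ρ : A ⊗[k] A) = Q.ρ := hg c
    cases sign
    -- `g ⊗ g` is multiplicative, so it fixes the inverse of the fixed element ρ.
    · have hρ' : Algebra.TensorProduct.map (g c : A →ₐ[k] A) (g c : A →ₐ[k] A)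
          (↑Q.ρ⁻¹ : A ⊗[k] A) = ↑Q.ρ⁻¹ := by
        apply Units.eq_inv_of_mul_eq_one_left
        conv_lhs => rw [← hρ]
        rw [← map_mul, Units.mul_inv, map_one]
      simp only [sumSignifiers, key, hL]
      rw [← map_sum, ← map_sum, ← S.ρ_inv_eq]
      conv_rhs => rw [← hρ', S.ρ_inv_eq]
      simp
    · simp only [sumSignifiers, key, hL]
      rw [← map_sum, ← map_sum, ← S.ρ_eq]
      conv_rhs => rw [← hρ, S.ρ_eq]
      simp

/-! ### Multilinearity of formal words and reversal of products -/

theorem wordProd_congr : ∀ (w : List (Letter k A)) {x y : ℕ → Bool → A},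
    (∀ l ∈ w, x l.crossing l.second = y l.crossing l.second) → wordProd w x = wordProd w y
  | w, x, y, h => by
    unfold wordProd
    congr 1
    exact List.map_congr_left fun l hl => by rw [h l hl]

theorem wordProd_cons (l : Letter k A) (w : List (Letter k A)) (x : ℕ → Bool → A) :
    wordProd (l :: w) x =
      TensorAlgebra.ι k (l.op (x l.crossing l.second)) * wordProd w x := by
  simp [wordProd]

/-- The letter `(c, b)` occurs exactly once, so the product is linear in its value once all other
values are frozen to those of `x`. -/
theorem exists_linear_wordProd {c : ℕ} {b : Bool} (x : ℕ → Bool → A) :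
    ∀ w : List (Letter k A), (w.map fun l => (l.crossing, l.second)).Nodup →
      (c, b) ∈ (w.map fun l => (l.crossing, l.second)) →
      ∃ L : A →ₗ[k] TensorAlgebra k A, ∀ z : ℕ → Bool → A,
        (∀ d b', (d, b') ≠ (c, b) → z d b' = x d b') → wordProd w z = L (z c b)
  | [], _, h => by simp at h
  | l :: w, hn, h => by
    rw [List.map_cons, List.nodup_cons] at hn
    by_cases hl : (l.crossing, l.second) = (c, b)
    · refine ⟨LinearMap.mulRight k (wordProd w x) ∘ₗ TensorAlgebra.ι k ∘ₗ l.op.toLinearMap,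
        fun z hz => ?_⟩
      rw [wordProd_cons, wordProd_congr w (y := x)]
      · obtain ⟨h₁, h₂⟩ := Prod.mk.inj hl
        simp [h₁, h₂]
      · intro l' hl'
        refine hz _ _ fun he => hn.1 ?_
        rw [hl, ← he]
        exact List.mem_map_of_mem (f := fun l : Letter k A => (l.crossing, l.second)) hl'
    · rw [List.map_cons, List.mem_cons] at h
      obtain ⟨L, hL⟩ := exists_linear_wordProd x w hn.2 (h.resolve_left fun he => hl he.symm)
      refine ⟨LinearMap.mulLeft k (TensorAlgebra.ι k (l.op (x l.crossing l.second))) ∘ₗ L,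
        fun z hz => ?_⟩
      rw [wordProd_cons, hL z hz, hz _ _ hl]
      simp

theorem bilinearAt_wordProd {w : List (Letter k A)} {c : ℕ}
    (hn : (w.map fun l => (l.crossing, l.second)).Nodup)
    (hc : ∀ b, (c, b) ∈ w.map fun l => (l.crossing, l.second)) : BilinearAt (wordProd w) c := by
  intro x
  have h₁ : ∀ a' : A, ∃ L : A →ₗ[k] TensorAlgebra k A, ∀ a, wordProd w
      (Function.update x c fun second => if second then a' else a) = L a := by
    intro a'
    obtain ⟨L, hL⟩ := exists_linear_wordProd
      (Function.update x c fun second => if second then a' else 0) w hn (hc false)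
    refine ⟨L, fun a => ?_⟩
    rw [hL]
    · simp
    · intro d b hdb
      by_cases hd : d = c
      · subst hd
        cases b
        · exact absurd rfl hdb
        · simp
      · simp [hd]
  have h₂ : ∀ a : A, ∃ L : A →ₗ[k] TensorAlgebra k A, ∀ a', wordProd w
      (Function.update x c fun second => if second then a' else a) = L a' := by
    intro a
    obtain ⟨L, hL⟩ := exists_linear_wordProd
      (Function.update x c fun second => if second then 0 else a) w hn (hc true)
    refine ⟨L, fun a' => ?_⟩
    rw [hL]
    · simp
    · intro d b hdb
      by_cases hd : d = c
      · subst hd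
        cases b
        · simp
        · exact absurd rfl hdb
      · simp [hd]
  choose L₁ hL₁ using h₁
  choose L₂ hL₂ using h₂
  refine ⟨TensorProduct.lift (LinearMap.mk₂ k (fun a a' => wordProd w
      (Function.update x c fun second => if second then a' else a)) ?_ ?_ ?_ ?_), fun a a' => ?_⟩
  · intro a b a'
    simp only [hL₁, map_add]
  · intro r a a'
    simp only [hL₁, map_smul]
  · intro a a' b'
    simp only [hL₂, map_add]
  · intro r a a'
    simp only [hL₂, map_smul]
  · simp

theorem map_sumSignifiers {Q : OrientedQuantumAlgebra k A} {ι κ : Type*} [Fintype ι]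
    [Fintype κ] (S : Signifiers Q ι κ) (φ : TensorAlgebra k A →ₗ[k] TensorAlgebra k A)
    (F : (ℕ → Bool → A) → TensorAlgebra k A) : ∀ (cs : List (ℕ × Bool)) (x : ℕ → Bool → A),
      φ (sumSignifiers S F cs x) = sumSignifiers S (fun x => φ (F x)) cs x
  | [], _ => rfl
  | (_, true) :: cs, _ => by simp only [sumSignifiers, map_sum, map_sumSignifiers S φ F cs]
  | (_, false) :: cs, _ => by simp only [sumSignifiers, map_sum, map_sumSignifiers S φ F cs]

theorem reverseProducts_prod (l : List A) :
    reverseProducts k A (l.map (TensorAlgebra.ι k)).prod =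
      (l.reverse.map (TensorAlgebra.ι k)).prod := by
  simp only [reverseProducts, LinearMap.comp_apply, AlgHom.toLinearMap_apply, map_list_prod,
    List.map_map]
  induction l with
  | nil => simp
  | cons a l ih =>
    simp only [LinearEquiv.coe_coe, MulOpposite.coe_opLinearEquiv_symm] at ih ⊢
    simp [ih]

theorem reverseProducts_wordProd (w : List (Letter k A)) (x : ℕ → Bool → A) :
    reverseProducts k A (wordProd w x) = wordProd w.reverse x := by
  have h : ∀ w : List (Letter k A), wordProd w x =
      ((w.map fun l => l.op (x l.crossing l.second)).map (TensorAlgebra.ι k)).prod := by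
    intro w
    rw [wordProd, List.map_map]
    rfl
  rw [h, h, reverseProducts_prod, ← List.map_reverse]

end Algebra

theorem Tangle.reverseProducts_expr {k A : Type*} [CommRing k] [Ring A] [Algebra k A]
    {a b : List Bool} (T : Tangle a b) {Q : OrientedQuantumAlgebra k A}
    {ι κ : Type*} [Fintype ι] [Fintype κ] (S : Signifiers Q ι κ) (w : List (Letter k A)) :
    reverseProducts k A (T.expr S w) = T.expr S w.reverse := by
  simp only [Tangle.expr, map_sumSignifiers, reverseProducts_wordProd]

/-- Application of `U ^ i D ^ j`, where `(i, j)` depends on the crossing only. -/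
def Bead.shift (h : ℕ → ℤ × ℤ) (b : Bead) : Bead := { b with op := b.op + h b.crossing }

/-- The crossing and the signifier of a bead. -/
def Bead.key (b : Bead) : ℕ × Bool := (b.crossing, b.second)

theorem Tangle.expr_map_shift {k A : Type*} [CommRing k] [Ring A] [Algebra k A]
    {a b : List Bool} (T : Tangle a b) {Q : OrientedQuantumAlgebra k A}
    {ι κ : Type*} [Fintype ι] [Fintype κ] (S : Signifiers Q ι κ) {w : List Bead}
    (hc : (T.crossings.map Prod.fst).Nodup) (hn : (w.map Bead.key).Nodup)
    (hw : ∀ c ∈ T.crossings.map Prod.fst, ∀ second, (c, second) ∈ w.map Bead.key)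
    (h : ℕ → ℤ × ℤ) :
    T.expr S ((w.map (Bead.shift h)).map (Bead.letter Q)) = T.expr S (w.map (Bead.letter Q)) := by
  have hk : ((w.map (Bead.letter Q)).map fun l => (l.crossing, l.second)) = w.map Bead.key := by
    rw [List.map_map]
    rfl
  have := sumSignifiers_comp_stabilizer S (F := wordProd (w.map (Bead.letter Q)))
    (g := fun c => Q.U ^ (h c).1 * Q.D ^ (h c).2)
    (fun c => Q.zpow_mul_zpow_mem_stabilizer _ _) T.crossings hc
    (fun c hc => bilinearAt_wordProd (hk ▸ hn) (hk ▸ hw c hc)) fun _ _ => 0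
  -- The summation starts from the zero assignment, which every automorphism fixes.
  simp only [map_zero] at this
  rw [Tangle.expr, Tangle.expr, ← this]
  congr 1
  funext x
  simp only [wordProd, List.map_map]
  congr 1
  refine List.map_congr_left fun b _ => ?_
  simp only [Function.comp_apply, Bead.letter, Bead.shift, Q.zpow_mul_zpow_add, AlgEquiv.mul_apply]

/-! ### Reversal of the orientation of flat diagrams -/

theorem Piece.rev_dom {X : Type} (P : Piece X) : P.rev.dom = P.dom.map not := by
  cases P <;> simp [Piece.rev, Piece.dom]

theorem Piece.rev_cod {X : Type} (P : Piece X) : P.rev.cod = P.cod.map not := by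
  cases P <;> simp [Piece.rev, Piece.cod]

theorem FlatMove.rev {u v : List (Layer Unit)} (h : FlatMove u v) :
    FlatMove (u.map Layer.rev) (v.map Layer.rev) := by
  cases h with
  | interchange P P' m =>
    simpa [Layer.rev, Piece.rev_dom, Piece.rev_cod] using
      FlatMove.interchange P.rev P'.rev (m.map not)
  | zigzag s => exact .zigzag !s
  | zigzag' s => exact .zigzag' !s
  | two s₁ s₂ => exact .two (!s₁) !s₂
  | three s₁ s₂ s₃ => exact .three (!s₁) (!s₂) !s₃
  | switchCap s x => exact .switchCap (!s) !x
  | switchCup s x => exact .switchCup (!s) !x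

theorem Layer.rev_pad {X : Type} (l r : List Bool) (L : Layer X) :
    (L.pad l r).rev = L.rev.pad (l.map not) (r.map not) := by
  simp [Layer.rev, Layer.pad]

theorem FlatStep.rev {a b : List Bool} {d d' : List (Layer Unit)} (h : FlatStep a b d d') :
    FlatStep (a.map not) (b.map not) (d.map Layer.rev) (d'.map Layer.rev) := by
  obtain ⟨hd, hd', below, above, u, v, l, r, hm, rfl, rfl⟩ := h
  refine ⟨hd.rev, hd'.rev, below.map Layer.rev, above.map Layer.rev, _, _, l.map not, r.map not,
    hm.rev, ?_, ?_⟩ <;> simp [Layer.rev_pad]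

theorem FlatEquiv.rev {a b : List Bool} {d d' : List (Layer Unit)} (h : FlatEquiv a b d d') :
    FlatEquiv (a.map not) (b.map not) (d.map Layer.rev) (d'.map Layer.rev) := by
  induction h with
  | rel _ _ h => exact .rel _ _ h.rev
  | refl _ => exact .refl _
  | symm _ _ _ ih => exact .symm _ _ ih
  | trans _ _ _ _ _ ih ih' => exact .trans _ _ _ ih ih'

theorem rev_curls (s : Bool) (n : ℤ) : (curls s n).map Layer.rev = curls (!s) (-n) := by
  have h₁ : (curlRight s).map Layer.rev = curlRight !s := rfl
  have h₂ : (curlLeft s).map Layer.rev = curlLeft !s := rfl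
  rcases eq_or_ne n 0 with rfl | hn
  · simp [curls]
  -- The test `0 ≤ n` flips under negation only for nonzero `n`. The side of the loop is then
  -- unchanged, as both the sign and the test flip.
  · have : decide (0 ≤ -n) = !decide (0 ≤ n) := by
      rw [← decide_not, decide_eq_decide]
      omega
    simp only [curls, this, List.map_flatten, List.map_replicate, Int.natAbs_neg, Bool.not_inj_iff]
    split_ifs
    · rw [h₁]
    · rw [h₂]

theorem Tangle.flat_rev {a b : List Bool} (T : Tangle a b) :
    T.rev.flat = T.flat.map Layer.rev := by
  simp only [Tangle.flat, Tangle.rev, List.map_map]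
  refine List.map_congr_left fun L _ => ?_
  rcases L with ⟨l, p, r⟩
  cases p <;> rfl

/-! ### Reversal of the orientation and walks -/

theorem Layer.across_rev {X : Type} (L : Layer X) (top : Bool) (p : ℕ) :
    L.rev.across top p = L.across top p := by
  rcases L with ⟨l, q, r⟩
  cases q <;> cases top <;> simp [Layer.rev, Piece.rev, Layer.across]

theorem entered_rev {X : Type} (d : List (Layer X)) (x : Pt) :
    entered (d.map Layer.rev) x = (entered d x).map fun y => (y.1, y.2.1.rev, y.2.2) := by
  unfold entered
  split_ifs <;> simp [Function.comp_def]

theorem next_rev {X : Type} (d : List (Layer X)) : next (d.map Layer.rev) = next d := by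
  funext x
  simp only [next, entered_rev, Option.map_map, Function.comp_def, Layer.across_rev]

theorem Tangle.width_rev {a b : List Bool} (T : Tangle a b) (i : ℕ) : T.rev.width i = T.width i := by
  simp only [Tangle.width, Tangle.rev, List.getElem?_map]
  cases T.layers[i]? <;> simp [Layer.dom_rev]

/-- The walk ignores orientations and always runs from bottom to top, so the same path serves both
diagrams. -/
theorem Tangle.IsTraversal.rev {s s' : Bool} {T : Tangle [s] [s']} {path : List Pt}
    (h : T.IsTraversal path) : Tangle.IsTraversal (s := !s) (s' := !s') T.rev path where
  start := h.start
  chain := by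
    have := h.chain
    simp only [Tangle.rev, next_rev]
    exact this
  finish := by
    rw [h.finish]
    simp [Tangle.rev]
  nodup := h.nodup
  covers i hi p hp := h.covers i (by simpa [Tangle.rev] using hi) p (T.width_rev i ▸ hp)

/-- Exchange of `U` and `D`. -/
def Bead.swap (b : Bead) : Bead := { b with op := b.op.swap }

/-- Exchange of `U` and `D`. -/
def Event.swap : Event → Event
  | .bead b => .bead b.swap
  | .turn v => .turn v.swap

theorem turnOp_not (s : Bool) : turnOp (!s) = (turnOp s).swap := by cases s <;> rfl

theorem crossingBead_not (c : ℕ) (o s₁ s₂ onSlash : Bool) :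
    crossingBead c o (!s₁) (!s₂) onSlash = (crossingBead c o s₁ s₂ onSlash).swap := by
  cases s₁ <;> cases s₂ <;> cases onSlash <;> rfl

theorem Layer.event_rev (i : ℕ) (L : Layer Bool) (top : Bool) (p : ℕ) :
    L.rev.event i top p = (L.event i top p).map Event.swap := by
  rcases L with ⟨l, q, r⟩
  cases q <;> cases top <;> simp only [Layer.rev, Piece.rev, Layer.event, List.length_map] <;>
    (try split_ifs) <;> simp [Event.swap, turnOp_not, crossingBead_not]

theorem Tangle.events_rev {a b : List Bool} (T : Tangle a b) (path : List Pt) :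
    T.rev.events path = (T.events path).map Event.swap := by
  simp only [Tangle.events, Tangle.rev, entered_rev, List.map_filterMap]
  congr 1
  funext x
  cases entered T.layers x <;> simp [Layer.event_rev]

theorem netTurn_swap : ∀ es : List Event, netTurn (es.map Event.swap) = (netTurn es).swap
  | [] => rfl
  | .turn v :: es => by simp [netTurn, Event.swap, netTurn_swap es]
  | .bead _ :: es => by simp [netTurn, Event.swap, netTurn_swap es]

theorem slideForward_swap : ∀ es : List Event,
    slideForward (es.map Event.swap) = (slideForward es).map Bead.swap
  | [] => rfl
  | .turn _ :: es => by simp [slideForward, Event.swap, slideForward_swap es]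
  | .bead _ :: es => by
    simp [slideForward, Event.swap, Bead.swap, slideForward_swap es, netTurn_swap]

theorem Tangle.crossings_rev {a b : List Bool} (T : Tangle a b) :
    T.rev.crossings = T.crossings := by
  simp only [Tangle.crossings, Tangle.rev, List.zipIdx_map, List.filterMap_map]
  congr 1
  funext ⟨⟨l, q, r⟩, i⟩
  rcases q with s | s | ⟨o, s₁, s₂⟩
  · rfl
  · rfl
  · cases s₁ <;> cases s₂ <;> rfl

/-! ### Signs along a walk -/

/-- The signs on the lower or on the upper edge of a layer. -/
def Layer.edge {X : Type} (L : Layer X) (top : Bool) : List Bool := if top then L.cod else L.dom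

/-- The vertical component of a direction. -/
def height (s : Bool) : ℤ := if s then 1 else 0

/-- The exponent of `U` minus the exponent of `D`. -/
def weight (v : ℤ × ℤ) : ℤ := v.1 - v.2

theorem weight_add (u v : ℤ × ℤ) : weight (u + v) = weight u + weight v := by
  simp only [weight, Prod.fst_add, Prod.snd_add]
  ring

theorem weight_neg (v : ℤ × ℤ) : weight (-v) = -weight v := by
  simp only [weight, Prod.fst_neg, Prod.snd_neg]
  ring

theorem weight_turnOp (s : Bool) : weight (turnOp s) = height s - height !s := by
  cases s <;> rfl

/-- The sign of the `\` strand of a crossing. -/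
def Piece.backslash {X : Type} : Piece X → Bool
  | .cross _ _ s₂ => s₂
  | _ => false

/-- How the sign `σ` of a strand changes to `τ` when an event is met; here `ν` is the sign of the
`\` strand at the crossing that has the number `i`. -/
def Event.Changes (i : ℕ) (ν σ τ : Bool) : Option Event → Prop
  | none => σ = τ
  | some (.turn v) => weight v = height τ - height σ
  | some (.bead b) => σ = τ ∧ b.crossing = i ∧ weight b.op = height σ - height ν

/-- The local form of the weight argument, checked for every type of layer and every point of entry.
-/
theorem Layer.across_edge (i : ℕ) (L : Layer Bool) (top : Bool) (p : ℕ) (σ : Bool)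
    (h : (L.edge top)[p]? = some σ) :
    ∃ τ, (L.edge (L.across top p).1)[(L.across top p).2]? = some τ ∧
      Event.Changes i L.piece.backslash σ τ (L.event i top p) := by
  rcases L with ⟨l, q, r⟩
  rcases lt_or_ge p l.length with hp | hp
  · rcases q with s | s | ⟨o, s₁, s₂⟩ <;> cases top <;>
      simp_all [Layer.edge, Layer.across, Layer.event, Layer.dom, Layer.cod, Piece.dom, Piece.cod,
        List.getElem?_append, Event.Changes, hp.ne, (Nat.lt_succ_of_lt hp).ne]
  -- Offsets `0` and `1` are the two legs of the piece; larger ones belong to the strands on its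
  -- right.
  · obtain ⟨m, rfl⟩ := Nat.exists_eq_add_of_le hp
    rcases q with s | s | ⟨o, s₁, s₂⟩ <;> cases top <;> rcases m with _ | _ | m <;>
      simp_all [Layer.edge, Layer.across, Layer.event, Layer.dom, Layer.cod, Piece.dom, Piece.cod,
        List.getElem?_append, Event.Changes, Piece.backslash, weight_turnOp, weight_neg,
        crossingBead]
    all_goals first
      | grind
      | rfl
      | (cases σ <;> cases s₂ <;> rfl)
      | (cases σ <;> simp [height])

/-- The signs at a level of a diagram with output signs `b`. -/
def signsAt {X : Type} (d : List (Layer X)) (b : List Bool) (i : ℕ) : List Bool :=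
  match d[i]? with
  | some L => L.dom
  | none => b

theorem IsMor.signsAt_zero {X : Type} {a b : List Bool} {d : List (Layer X)} (h : IsMor a d b) :
    signsAt d b 0 = a := by
  cases d with
  | nil => exact h.symm
  | cons L d => exact h.1.symm

theorem IsMor.signsAt_succ {X : Type} : ∀ {a b : List Bool} {d : List (Layer X)}, IsMor a d b →
    ∀ {i : ℕ} {L : Layer X}, d[i]? = some L → signsAt d b (i + 1) = L.cod
  | _, _, [], _, _, _, hi => by simp at hi
  | _, _, M :: _, h, 0, L, hi => by
    obtain rfl : M = L := by simpa using hi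
    exact h.2.signsAt_zero
  | _, _, _ :: _, h, _ + 1, _, hi => h.2.signsAt_succ (by simpa using hi)

/-- The point on the lower or on the upper edge of a layer at which the walk enters it. -/
def Pt.enter (i : ℕ) (top : Bool) (p : ℕ) : Pt := ⟨if top then i + 1 else i, p, !top⟩

/-- The same point, passed in the opposite direction. -/
def Pt.flip (x : Pt) : Pt := ⟨x.level, x.pos, !x.up⟩

theorem entered_eq_some {X : Type} {d : List (Layer X)} {x : Pt} {i : ℕ} {L : Layer X} {top : Bool} :
    entered d x = some (i, L, top) ↔ d[i]? = some L ∧ x = Pt.enter i top x.pos := by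
  rcases x with ⟨n, p, up⟩
  cases up
  · rcases n with _ | n
    · cases top <;> simp [entered, Pt.enter]
    · simp only [entered, Pt.enter]
      cases top <;> (simp; try aesop)
  · cases top <;> simp [entered, Pt.enter]
    aesop

theorem next_enter {X : Type} {d : List (Layer X)} {i : ℕ} {L : Layer X} (h : d[i]? = some L)
    (top : Bool) (p : ℕ) : next d (Pt.enter i top p) =
      some (Pt.enter i (L.across top p).1 (L.across top p).2).flip := by
  rw [next, entered_eq_some.2 ⟨h, rfl⟩]
  simp only [Option.map_some, Pt.enter, Pt.flip]
  split_ifs with h <;> simp [h]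

theorem exists_enter_of_next {X : Type} {d : List (Layer X)} {x y : Pt} (h : next d x = some y) :
    ∃ i L top, d[i]? = some L ∧ x = Pt.enter i top x.pos ∧
      y = (Pt.enter i (L.across top x.pos).1 (L.across top x.pos).2).flip := by
  obtain ⟨⟨i, L, top⟩, he, -⟩ := Option.map_eq_some_iff.1 h
  obtain ⟨hL, hx⟩ := entered_eq_some.1 he
  refine ⟨i, L, top, hL, hx, ?_⟩
  rw [hx, next_enter hL] at h
  exact (Option.some.inj h).symm

namespace Tangle
variable {a b : List Bool}

/-- The sign of the strand at a point. -/
def sign (T : Tangle a b) (x : Pt) : Option Bool := (signsAt T.layers b x.level)[x.pos]?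

/-- What is met directly after a point of a walk. -/
def eventAt (T : Tangle a b) (x : Pt) : Option Event :=
  (entered T.layers x).bind fun y => y.2.1.event y.1 y.2.2 x.pos

theorem eventAt_enter (T : Tangle a b) {i : ℕ} {L : Layer Bool} (h : T.layers[i]? = some L)
    (top : Bool) (p : ℕ) : T.eventAt (Pt.enter i top p) = L.event i top p := by
  rw [eventAt, entered_eq_some.2 ⟨h, rfl⟩]
  rfl

theorem sign_enter (T : Tangle a b) {i : ℕ} {L : Layer Bool} (h : T.layers[i]? = some L)
    (top : Bool) (p : ℕ) : T.sign (Pt.enter i top p) = (L.edge top)[p]? := by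
  cases top
  · simp [sign, Pt.enter, signsAt, h, Layer.edge]
  · simp [sign, Pt.enter, T.isMor.signsAt_succ h, Layer.edge]

/-- The sign of the `\` strand of the crossing with number `i`. -/
def backslash (T : Tangle a b) (i : ℕ) : Bool :=
  (T.layers[i]?.map fun L => L.piece.backslash).getD false

theorem changes_of_next (T : Tangle a b) {x y : Pt} (h : next T.layers x = some y) {σ : Bool}
    (hσ : T.sign x = some σ) : ∃ i τ, T.sign y = some τ ∧
      Event.Changes i (T.backslash i) σ τ (T.eventAt x) := by
  obtain ⟨i, L, top, hL, hx, rfl⟩ := exists_enter_of_next h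
  rw [hx, T.sign_enter hL] at hσ
  obtain ⟨τ, hτ, hc⟩ := L.across_edge i top x.pos σ hσ
  refine ⟨i, τ, ?_, ?_⟩
  · rw [← hτ, ← T.sign_enter hL]
    rfl
  · rw [hx, T.eventAt_enter hL, backslash, hL]
    exact hc

theorem events_cons (T : Tangle a b) (x : Pt) (path : List Pt) :
    T.events (x :: path) = (T.eventAt x).toList ++ T.events path := by
  change (x :: path).filterMap T.eventAt = _ ++ path.filterMap T.eventAt
  rw [List.filterMap_cons]
  cases T.eventAt x <;> rfl

/-- Telescoping: the turns after a bead contribute the height of the final sign minus that of the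
sign at the bead, and the latter cancels against the initial weight of the bead. -/
theorem weight_slideForward (T : Tangle a b) {τ : Bool} : ∀ (path : List Pt) (x : Pt),
    (x :: path).IsChain (fun x y => next T.layers x = some y) →
    (∀ z, (x :: path).getLast? = some z → T.sign z = some τ ∧ T.eventAt z = none) →
    ∀ σ, T.sign x = some σ →
      weight (netTurn (T.events (x :: path))) = height τ - height σ ∧
        ∀ b ∈ slideForward (T.events (x :: path)),
          weight b.op = height τ - height (T.backslash b.crossing)
  | [], x, _, hz, σ, hσ => by
    obtain ⟨h₁, h₂⟩ := hz x rfl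
    obtain rfl : τ = σ := by simpa [h₁] using hσ
    have h₃ : T.events [x] = [] := by
      rw [events_cons, h₂]
      rfl
    simp [h₃, netTurn, slideForward, weight]
  | y :: path, x, hc, hz, σ, hσ => by
    rw [List.isChain_cons_cons] at hc
    obtain ⟨i, ρ, hρ, he⟩ := T.changes_of_next hc.1 hσ
    obtain ⟨ih₁, ih₂⟩ := weight_slideForward T path y hc.2
      (fun z h => hz z (by rw [List.getLast?_cons_cons]; exact h)) ρ hρ
    rw [events_cons]
    rcases hx : T.eventAt x with _ | b | v
    · rw [hx] at he
      obtain rfl : σ = ρ := he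
      exact ⟨ih₁, ih₂⟩
    · rw [hx] at he
      obtain ⟨rfl, rfl, hw⟩ := he
      refine ⟨ih₁, fun b' hb => ?_⟩
      rcases List.mem_cons.1 hb with rfl | hb
      · simp only [weight_add, hw]
        change height _ - height _ + weight (netTurn (T.events (y :: path))) = _
        rw [ih₁]
        ring
      · exact ih₂ b' hb
    · rw [hx] at he
      have hw : weight v = height ρ - height σ := he
      refine ⟨?_, ih₂⟩
      change weight (v + netTurn (T.events (y :: path))) = _
      rw [weight_add, ih₁, hw]
      ring

end Tangle

/-- Sliding back over the turns before a bead instead of forward over those after it differs by the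
total turn of the walk, the same for all beads. -/
theorem slideBackward_eq : ∀ (es : List Event) (v : ℤ × ℤ),
    slideBackward v es = (slideForward es).map (Bead.shift fun _ => -(v + netTurn es))
  | [], _ => rfl
  | .turn u :: es, v => by
    simp [slideBackward, slideForward, netTurn, slideBackward_eq es, add_assoc]
  | .bead b :: es, v => by
    simp only [slideBackward, slideForward, netTurn, slideBackward_eq es, List.map_cons]
    congr 1
    simp only [Bead.shift]
    congr 1
    abel

/-! ### Every signifier occurs exactly once -/

/-- The crossing and the signifier of a bead that is met. -/
def Event.key : Event → Option (ℕ × Bool)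
  | .bead b => some b.key
  | .turn _ => none

theorem map_key_slideForward : ∀ es : List Event,
    (slideForward es).map Bead.key = es.filterMap Event.key
  | [] => rfl
  | .turn _ :: es => map_key_slideForward es
  | .bead b :: es => congrArg (b.key :: ·) (map_key_slideForward es)

/-- A signifier sits on one strand of its crossing, which can be entered only at its two ends. -/
theorem Layer.key_unique {i c : ℕ} {L : Layer Bool} {top top' b : Bool} {p p' : ℕ}
    (h : (L.event i top p).bind Event.key = some (c, b))
    (h' : (L.event i top' p').bind Event.key = some (c, b)) :
    (top', p') = (top, p) ∨ (top', p') = L.across top p := by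
  rcases L with ⟨l, q, r⟩
  rcases q with s | s | ⟨o, s₁, s₂⟩
  · cases top <;> simp only [Layer.event] at h <;> (try split_ifs at h) <;> simp [Event.key] at h
  · cases top <;> simp only [Layer.event] at h <;> (try split_ifs at h) <;> simp [Event.key] at h
  · cases top <;> cases top' <;> simp only [Layer.event] at h h' <;> split_ifs at h h' <;>
      simp_all [Event.key, Bead.key, crossingBead, Layer.across]

theorem Layer.crossing_of_key {i c : ℕ} {L : Layer Bool} {top b : Bool} {p : ℕ}
    (h : (L.event i top p).bind Event.key = some (c, b)) : c = i := by
  rcases L with ⟨l, q, r⟩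
  rcases q with s | s | ⟨o, s₁, s₂⟩ <;> cases top <;> simp only [Layer.event] at h <;>
    (try split_ifs at h) <;> simp_all [Event.key, Bead.key, crossingBead]

theorem Layer.exists_key {i : ℕ} {L : Layer Bool} {o s₁ s₂ : Bool} (hL : L.piece = .cross o s₁ s₂)
    (b : Bool) : ∃ p < L.dom.length, (L.event i false p).bind Event.key = some (i, b) ∧
      ∀ top p', L.across top p' = (false, p) →
        (L.event i top p').bind Event.key = some (i, b) := by
  rcases L with ⟨l, q, r⟩
  obtain rfl : q = .cross o s₁ s₂ := hL
  -- The `\` strand, with lower end at `l.length + 1`, carries the signifier flagged `o`; the `/`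
  -- strand carries the other.
  by_cases hb : b = o
  · subst hb
    refine ⟨l.length + 1, by simp [Layer.dom, Piece.dom], ?_, fun top p' h => ?_⟩
    · simp [Layer.event, Event.key, Bead.key, crossingBead]
    · cases top
      · simp [Layer.across] at h
      · obtain rfl : p' = l.length := by
          simp only [Layer.across, Prod.mk.injEq] at h
          split_ifs at h <;> omega
        simp [Layer.event, Event.key, Bead.key, crossingBead]
  · obtain rfl : b = !o := by cases b <;> cases o <;> simp_all
    refine ⟨l.length, by simp [Layer.dom, Piece.dom], ?_, fun top p' h => ?_⟩
    · simp [Layer.event, Event.key, Bead.key, crossingBead]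
    · cases top
      · simp [Layer.across] at h
      · obtain rfl : p' = l.length + 1 := by
          simp only [Layer.across, Prod.mk.injEq] at h
          split_ifs at h <;> omega
        simp [Layer.event, Event.key, Bead.key, crossingBead]

theorem flip_enter_ne_enter {i : ℕ} {top top' : Bool} {p p' : ℕ} :
    (Pt.enter i top p).flip ≠ Pt.enter i top' p' := by
  intro h
  cases top <;> cases top' <;> simp [Pt.enter, Pt.flip] at h

theorem next_finish {X : Type} (d : List (Layer X)) : next d ⟨d.length, 0, true⟩ = none := by
  simp [next, entered]

namespace Tangle
variable {a b : List Bool}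

theorem exists_of_mem_crossings {T : Tangle a b} {c : ℕ} (h : c ∈ T.crossings.map Prod.fst) :
    ∃ L o s₁ s₂, T.layers[c]? = some L ∧ L.piece = .cross o s₁ s₂ := by
  simp only [crossings, List.mem_map, List.mem_filterMap] at h
  obtain ⟨⟨c', v⟩, ⟨⟨L, i⟩, hi, hL⟩, rfl⟩ := h
  rw [List.mem_zipIdx_iff_getElem?] at hi
  rcases hp : L.piece with s | s | ⟨o, s₁, s₂⟩ <;> simp only [hp] at hL
  · cases hL
  · cases hL
  · obtain ⟨rfl, -⟩ : i = c' ∧ _ := by simpa using hL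
    exact ⟨L, o, s₁, s₂, hi, hp⟩

theorem nodup_crossings (T : Tangle a b) : (T.crossings.map Prod.fst).Nodup := by
  rw [crossings, List.Nodup, List.pairwise_map, List.pairwise_filterMap]
  have h : (T.layers.zipIdx.map Prod.snd).Nodup := by
    rw [List.zipIdx_map_snd]
    exact List.nodup_range'
  rw [List.Nodup, List.pairwise_map] at h
  refine h.imp ?_
  rintro ⟨L, i⟩ ⟨M, j⟩ hij ⟨c, v⟩ hc ⟨d, v'⟩ hd
  rcases hp : L.piece with s | s | ⟨o, s₁, s₂⟩ <;> simp only [hp] at hc <;>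
    rcases hq : M.piece with s' | s' | ⟨o', s₁', s₂'⟩ <;> simp only [hq] at hd <;> simp_all

variable {s s' : Bool}

namespace IsTraversal
variable {T : Tangle [s] [s']} {path : List Pt}

theorem next_mem (h : T.IsTraversal path) {x y : Pt} (hx : x ∈ path)
    (hy : next T.layers x = some y) : y ∈ path := by
  obtain ⟨j, hj, rfl⟩ := List.getElem_of_mem hx
  by_cases hj' : j + 1 < path.length
  · have := h.chain.getElem j hj'
    rw [hy] at this
    rw [Option.some.inj this]
    exact List.getElem_mem _
  · have hl := h.finish
    obtain rfl : j = path.length - 1 := by omega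
    rw [List.getLast?_eq_getElem?, List.getElem?_eq_getElem hj] at hl
    rw [Option.some.inj hl, next_finish] at hy
    cases hy

theorem exists_prev (h : T.IsTraversal path) {x : Pt} (hx : x ∈ path) (hup : x.up = false) :
    ∃ y ∈ path, next T.layers y = some x := by
  obtain ⟨j, hj, rfl⟩ := List.getElem_of_mem hx
  rcases j with _ | j
  · have hs := h.start
    rw [List.head?_eq_getElem?, List.getElem?_eq_getElem hj] at hs
    rw [Option.some.inj hs] at hup
    cases hup
  · exact ⟨path[j], List.getElem_mem _, h.chain.getElem j hj⟩

theorem eq_of_mem (h : T.IsTraversal path) {x y : Pt} (hx : x ∈ path) (hy : y ∈ path)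
    (hl : x.level = y.level) (hp : x.pos = y.pos) : x = y :=
  List.inj_on_of_nodup_map h.nodup hx hy (by rw [hl, hp])

theorem eventAt_key_iff {x : Pt} {c : ℕ} {v : Bool} :
    (T.eventAt x).bind Event.key = some (c, v) ↔ ∃ L top, T.layers[c]? = some L ∧
      x = Pt.enter c top x.pos ∧ (L.event c top x.pos).bind Event.key = some (c, v) := by
  constructor
  · intro h
    rcases he : entered T.layers x with _ | ⟨i, L, top⟩
    · simp [eventAt, he] at h
    · obtain ⟨hL, hx⟩ := entered_eq_some.1 he
      rw [hx, T.eventAt_enter hL] at h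
      obtain rfl := Layer.crossing_of_key h
      exact ⟨L, top, hL, hx, h⟩
  · rintro ⟨L, top, hL, hx, h⟩
    rw [hx, T.eventAt_enter hL]
    exact h

/-- Meeting a signifier at two different points would mean entering its strand from both ends. The
walk would then pass one point in both directions, although it visits each point once. -/
theorem key_injOn (h : T.IsTraversal path) {x y : Pt} (hx : x ∈ path) (hy : y ∈ path)
    {v : ℕ × Bool} (hxv : (T.eventAt x).bind Event.key = some v)
    (hyv : (T.eventAt y).bind Event.key = some v) : x = y := by
  obtain ⟨c, v⟩ := v
  obtain ⟨L, top, hL, hx', hk⟩ := eventAt_key_iff.1 hxv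
  obtain ⟨L', top', hL', hy', hk'⟩ := eventAt_key_iff.1 hyv
  obtain rfl : L = L' := by simpa [hL] using hL'
  rcases Layer.key_unique hk hk' with he | he
  · rw [hx', hy', (Prod.mk.inj he).1, (Prod.mk.inj he).2]
  · have hz := next_enter hL top x.pos
    rw [← he, ← hx'] at hz
    have := h.eq_of_mem (h.next_mem hx hz) hy (by rw [hy']; rfl) rfl
    rw [hy'] at this
    exact (flip_enter_ne_enter this).elim

theorem map_key_eq (T : Tangle [s] [s']) (path : List Pt) :
    (slideForward (T.events path)).map Bead.key =
      path.filterMap fun x => (T.eventAt x).bind Event.key := by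
  rw [map_key_slideForward]
  change (path.filterMap T.eventAt).filterMap Event.key = _
  rw [List.filterMap_filterMap]

theorem nodup_keys (h : T.IsTraversal path) :
    ((slideForward (T.events path)).map Bead.key).Nodup := by
  rw [map_key_eq, List.Nodup, List.pairwise_filterMap]
  have hn := h.nodup.of_map
  refine List.Pairwise.imp_of_mem (fun {x y} hx hy hxy v hv v' hv' hvv => ?_) hn
  subst hvv
  exact hxy (h.key_injOn hx hy hv hv')

theorem mem_keys (h : T.IsTraversal path) {c : ℕ} (hc : c ∈ T.crossings.map Prod.fst) (v : Bool) :
    (c, v) ∈ (slideForward (T.events path)).map Bead.key := by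
  obtain ⟨L, o, s₁, s₂, hL, hp⟩ := exists_of_mem_crossings hc
  obtain ⟨p, hpw, hk, hk'⟩ := Layer.exists_key (i := c) hp v
  rw [map_key_eq, List.mem_filterMap]
  have hw : p < T.width c := by rw [width, hL]; exact hpw
  have hcl : c < T.layers.length := (List.getElem?_eq_some_iff.1 hL).1
  obtain ⟨⟨n, q, up⟩, hx, hxe⟩ := List.mem_map.1 (h.covers c hcl.le p hw)
  obtain ⟨rfl, rfl⟩ := Prod.mk.inj hxe
  cases up
  -- The lower end of the strand is passed downward, so the walk has just left the crossing and met
  -- the bead at the preceding point.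
  · obtain ⟨y, hy, hyn⟩ := h.exists_prev hx rfl
    obtain ⟨i, M, top, hM, hy', hz⟩ := exists_enter_of_next hyn
    refine ⟨y, hy, ?_⟩
    have hup : (M.across top y.pos).1 = false := by
      have := congrArg Pt.up hz
      simpa [Pt.enter, Pt.flip] using this.symm
    rw [hup] at hz
    obtain ⟨rfl, rfl, -⟩ := Pt.mk.inj hz
    obtain rfl : L = M := by simpa [Pt.enter, hL] using hM
    exact eventAt_key_iff.2 ⟨L, top, hL, hy', hk' _ _ (Prod.ext hup rfl)⟩
  · exact ⟨_, hx, eventAt_key_iff.2 ⟨L, false, hL, rfl, hk⟩⟩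

theorem weight_eq {T : Tangle [s] [s]} (h : T.IsTraversal path) :
    ∀ b ∈ slideForward (T.events path),
      weight b.op = height s - height (T.backslash b.crossing) := by
  have hs := h.start
  rcases path with _ | ⟨x, path⟩
  · cases hs
  obtain rfl : x = ⟨0, 0, true⟩ := by simpa using hs
  refine (T.weight_slideForward path _ h.chain (τ := s) (fun z hz => ?_) s ?_).2
  · obtain rfl := Option.some.inj (h.finish.symm.trans hz)
    constructor
    · simp [sign, signsAt]
    · simp [eventAt, entered]
  · simp [sign, T.isMor.signsAt_zero]

end IsTraversal
end Tangle

/-! ### The two ends of the diagram and the two orientations -/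

theorem Bead.shift_shift (h h' : ℕ → ℤ × ℤ) (b : Bead) :
    (b.shift h).shift h' = b.shift (h + h') := by
  simp [Bead.shift, add_assoc]

/-- `(j, i) = (i, j) + (-(i - j), i - j)`: the exchange is a shift by the weight, hence invisible
when the weight depends on the crossing only. -/
theorem Bead.swap_eq_shift {h : ℕ → ℤ} {b : Bead} (hb : weight b.op = h b.crossing) :
    b.swap = b.shift fun c => (-h c, h c) := by
  have h₁ : b.op.swap = b.op + (-h b.crossing, h b.crossing) := by
    rw [← hb, weight]
    ext <;> simp
  simp [Bead.swap, Bead.shift, h₁]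

namespace Tangle

/-- The list of beads along a walk from the bottom to the top, read in the order of an orientation
that starts with the sign `s`. -/
def orient (s : Bool) (w : List Bead) : List Bead := if s then w else w.reverse

theorem orient_map (s : Bool) (f : Bead → Bead) (w : List Bead) :
    orient s (w.map f) = (orient s w).map f := by
  cases s <;> simp [orient]

theorem orient_not (s : Bool) (w : List Bead) : orient (!s) w = (orient s w).reverse := by
  cases s <;> simp [orient]

theorem orient_perm (s : Bool) (w : List Bead) : (orient s w).Perm w := by
  cases s
  · exact List.reverse_perm w
  · exact .refl w

theorem slide_eq {s s' : Bool} (toTop : Bool) (T : Tangle [s] [s']) (path : List Pt) :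
    ∃ h, T.slide toTop path = (orient s (slideForward (T.events path))).map (Bead.shift h) := by
  simp only [← orient_map]
  cases toTop
  · exact ⟨_, congrArg (orient s) (slideBackward_eq _ _)⟩
  · refine ⟨0, congrArg (orient s) ?_⟩
    have : Bead.shift 0 = id := by
      funext b
      simp [Bead.shift]
    rw [this, List.map_id]
    rfl

theorem IsTraversal.slide_rev_eq {s : Bool} (toTop : Bool) {T : Tangle [s] [s]} {path : List Pt}
    (h : T.IsTraversal path) : ∃ f, Tangle.slide (s := !s) (s' := !s) toTop T.rev path =
      (orient s (slideForward (T.events path))).reverse.map (Bead.shift f) := by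
  obtain ⟨f, hf⟩ := slide_eq (s := !s) (s' := !s) toTop T.rev path
  rw [hf, T.events_rev, slideForward_swap, List.map_congr_left fun b hb =>
    Bead.swap_eq_shift (h := fun c => height s - height (T.backslash c)) (h.weight_eq b hb),
    orient_map, List.map_map, orient_not]
  exact ⟨_, List.map_congr_left fun b _ => Bead.shift_shift _ _ b⟩

section
variable {k A : Type*} [CommRing k] [Ring A] [Algebra k A] {Q : OrientedQuantumAlgebra k A}
  {ι κ : Type*} [Fintype ι] [Fintype κ] (S : Signifiers Q ι κ)

theorem IsTraversal.expr_map_shift {s : Bool} {T : Tangle [s] [s]} {path : List Pt}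
    (h : T.IsTraversal path) {w : List Bead} (hw : w.Perm (slideForward (T.events path)))
    (f : ℕ → ℤ × ℤ) :
    T.expr S ((w.map (Bead.shift f)).map (Bead.letter Q)) = T.expr S (w.map (Bead.letter Q)) :=
  T.expr_map_shift S T.nodup_crossings ((hw.map _).nodup_iff.2 h.nodup_keys)
    (fun _ hc v => (hw.map _).mem_iff.2 (h.mem_keys hc v)) f

theorem expr_rev {a b : List Bool} (T : Tangle a b) (w : List (Letter k A)) :
    T.rev.expr S w = T.expr S w := by
  rw [expr, expr, T.crossings_rev]

end

end Tangle

/-! ### Invariants of the reversed tangle and powers of `t` -/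

section
variable {k A : Type*} [CommRing k] [Ring A] [Algebra k A] {Q : OrientedQuantumAlgebra k A}
  {ι κ : Type*} [Fintype ι] [Fintype κ] {S : Signifiers Q ι κ}

theorem HasExpr.rev {s toTop : Bool} {T : Tangle [s] [s]} {w : TensorAlgebra k A}
    (h : HasExpr S toTop T w) (toTop' : Bool) :
    HasExpr S toTop' (s := !s) T.rev (reverseProducts k A w) := by
  obtain ⟨path, hp, rfl⟩ := h
  refine ⟨path, hp.rev, ?_⟩
  obtain ⟨f, hf⟩ := T.slide_eq toTop path
  obtain ⟨f', hf'⟩ := hp.slide_rev_eq toTop'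
  have hperm := Tangle.orient_perm s (slideForward (T.events path))
  have h₁ : T.rev.expr S ((Tangle.slide (s := !s) (s' := !s) toTop' T.rev path).map
      (Bead.letter Q)) = T.expr S ((Tangle.orient s
        (slideForward (T.events path))).reverse.map (Bead.letter Q)) := by
    rw [hf', T.expr_rev, hp.expr_map_shift S ((List.reverse_perm _).trans hperm)]
  rw [T.reverseProducts_expr, hf, ← List.map_reverse, ← List.map_reverse,
    hp.expr_map_shift S ((List.reverse_perm _).trans hperm)]
  exact h₁.symm

theorem HasInv.rev {s toTop : Bool} {T : Tangle [s] [s]} {n : ℤ} {w : TensorAlgebra k A}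
    (h : HasInv S toTop T n w) (toTop' : Bool) :
    HasInv S toTop' (s := !s) T.rev (-n) (reverseProducts k A w) := by
  refine ⟨h.1.rev toTop', ?_⟩
  have := h.2.rev
  rw [rev_curls, ← T.flat_rev] at this
  exact this

theorem exists_op_eq {w : List Bead} (hn : (w.map Bead.key).Nodup) :
    ∃ m : ℕ → Bool → ℤ, ∀ b ∈ w, m b.crossing b.second = b.op.2 := by
  classical
  refine ⟨fun c v => if h : ∃ b ∈ w, b.key = (c, v) then h.choose.op.2 else 0, fun b hb => ?_⟩
  have h : ∃ b' ∈ w, b'.key = (b.crossing, b.second) := ⟨b, hb, rfl⟩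
  beta_reduce
  rw [dif_pos h, List.inj_on_of_nodup_map hn h.choose_spec.1 hb h.choose_spec.2]

theorem OrientedQuantumAlgebra.t_zpow (Q : OrientedQuantumAlgebra k A) (n : ℤ) :
    Q.t ^ n = Q.U ^ n * Q.D ^ n :=
  (show Commute Q.U Q.D from Q.commute_DU.symm).mul_zpow n

theorem HasExpr.exists_tLetter {s toTop : Bool} {T : Tangle [s] [s]} {w : TensorAlgebra k A}
    (h : HasExpr S toTop T w) :
    ∃ (path : List Pt) (m : ℕ → Bool → ℤ), T.IsTraversal path ∧
      w = T.expr S ((T.slide toTop path).map (Bead.tLetter Q m)) := by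
  obtain ⟨path, hp, rfl⟩ := h
  -- The power of `t` is the exponent of `D` on the bead slid to the top, whichever end `toTop`
  -- selects.
  obtain ⟨m, hm⟩ := exists_op_eq hp.nodup_keys
  refine ⟨path, m, hp, ?_⟩
  obtain ⟨f, hf⟩ := T.slide_eq toTop path
  have hperm := Tangle.orient_perm s (slideForward (T.events path))
  -- The shift `f` is dropped and replaced by minus the weight on `U`, which makes the two exponents
  -- equal.
  rw [hf, hp.expr_map_shift S hperm, ← hp.expr_map_shift S hperm
    fun c => (height (T.backslash c) - height s, 0), List.map_map, List.map_map]
  congr 1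
  refine List.map_congr_left fun b hb => ?_
  rw [hperm.mem_iff] at hb
  have hw := hp.weight_eq b hb
  have h₁ : b.op.1 + (height (T.backslash b.crossing) - height s) = b.op.2 := by
    rw [weight] at hw
    linarith
  simp [Bead.letter, Bead.tLetter, Bead.shift, hm b hb, h₁, Q.t_zpow]

end

end QTangle

theorem mainTheorem3 {k A : Type*} [CommRing k] [Ring A] [Algebra k A]
    (Q : QTangle.OrientedQuantumAlgebra k A) {ι κ : Type*} [Fintype ι] [Fintype κ]
    (S : QTangle.Signifiers Q ι κ) {s : Bool} (T : QTangle.Tangle [s] [s])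
    (hT : T.OneComponent) :
    (∀ (toTop toTop' : Bool) (n : ℤ) (w : TensorAlgebra k A),
      QTangle.HasInv S toTop T n w →
        QTangle.HasInv S toTop' (s := !s) T.rev (-n) (QTangle.reverseProducts k A w)) ∧
    (∀ (toTop : Bool) (w : TensorAlgebra k A),
      QTangle.HasExpr S toTop T w →
        ∃ (path : List QTangle.Pt) (m : ℕ → Bool → ℤ), T.IsTraversal path ∧
          w = T.expr S ((T.slide toTop path).map (QTangle.Bead.tLetter Q m))) :=
  ⟨fun _ toTop' _ _ h => h.rev toTop', fun _ _ h => h.exists_tLetter⟩
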